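/- Let $E\subset\mathbb{C}$ be a compact set and let $\|f\|_E=\sup_{z\in E}|f(z)|$. Let $\mathrm{cap}(E)=e^{-V_E}$ be the logarithmic capacity of $E$, where $V_E=\inf_\mu\iint\log\frac{1}{|z-w|}\,d\mu(z)\,d\mu(w)\in(-\infty,+\infty]$, the infimum being over all Borel probability measures $\mu$ supported on $E$ (and $\mathrm{cap}(E)=0$ if $V_E=+\infty$). Let $C_E$ denote the best (smallest) constant $C$ such that $$\|q\|_E\le C^n\,\|p\|_E,\qquad n=\deg p,$$ for every monic polynomial $p$ with complex coefficients and every monic factor $q$ of $p$. Suppose that $\mathrm{cap}(E)>0$. If $\mathrm{diam}(E)=\max_{z,\zeta\in E}|z-\zeta|\le 1$, then this smallest constant exists and $$C_E=\frac{1}{\mathrm{cap}(E)}.$$ -/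

import Mathlib

open MeasureTheory Polynomial

noncomputable section

/-- The logarithmic kernel `log (1 / |z - w|)` with values in `(-∞, +∞]`; it is `+∞` for `z = w`. -/
def logKernel (z w : ℂ) : EReal := -ENNReal.log (edist z w)

/-- The logarithmic energy `∬ log (1 / |z - w|) dμ(w) dμ(z)`, as the integral of the positive part
of the kernel minus the integral of its negative part. For a finite measure on a bounded set the
second integral is finite, so that the energy is well defined in `(-∞, +∞]`. -/
def logEnergy (μ : Measure ℂ) : EReal :=
  ((∫⁻ z, ∫⁻ w, (logKernel z w).toENNReal ∂μ ∂μ : ENNReal) : EReal) -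
    ((∫⁻ z, ∫⁻ w, (-logKernel z w).toENNReal ∂μ ∂μ : ENNReal) : EReal)

/-- The Robin constant of a compact set `E`: the infimum of the logarithmic energies of the Borel
probability measures carried by `E` (`+∞` if `E` carries no measure of finite energy). -/
def robinConstant (E : Set ℂ) : EReal :=
  ⨅ (μ : Measure ℂ) (_ : IsProbabilityMeasure μ) (_ : μ Eᶜ = 0), logEnergy μ

/-- The logarithmic capacity `cap(E) = exp (-V)` of a compact set `E`, where `V` is the Robin
constant of `E`; it is `0` if `V = +∞`. -/
def logCapacity (E : Set ℂ) : ℝ := (EReal.exp (-robinConstant E)).toReal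

/-- The uniform norm `‖p‖_E = sup_{z ∈ E} |p(z)|` of a polynomial. -/
def polySupNorm (E : Set ℂ) (p : ℂ[X]) : ℝ := ⨆ z : E, ‖p.eval (z : ℂ)‖

/-- The real constants `C` with `‖q‖_E ≤ C ^ n * ‖p‖_E`, `n = deg p`, for every monic polynomial `p`
and every monic factor `q` of `p`. The constant `C_E` is the least element of this set. -/
def factorConstants (E : Set ℂ) : Set ℝ :=
  {C | ∀ p q : ℂ[X], p.Monic → q.Monic → q ∣ p →
    polySupNorm E q ≤ C ^ p.natDegree * polySupNorm E p}

end

/-! Since `diam E ≤ 1`, the kernel is nonnegative on `E`. That `1 / cap(E)` is admissible rests on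
`cap(E) ^ n ≤ ‖s‖_E` for monic `s` of degree `n` (`logCapacity_pow_natDegree_le`). Fix `u ∈ E` and
reflect the roots of `p` outside the unit disc about `u` into it, which gives a monic `s` of the
same degree. As `E` lies in that disc, `|s| ≤ |p| / P` on `E` with `P = ∏ max(1, |z - u|)` over the
roots `z` of `p`, while `|q(u)| ≤ P`. Hence `|q(u)| cap(E) ^ n ≤ ‖p‖_E`. Conversely, `q = 1` alone
forces `C ≥ 1 / cap(E)`: an admissible `C` gives `1 ≤ C ^ n ‖p‖_E`, so a greedy (Leja) sequence in
`E` has mean kernel at most `log C` against its predecessors. A weak limit of its empirical measures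
has energy at most `log C` (`robinConstant_le_log`). -/

open scoped Topology

/-! ### The logarithmic kernel on a set of diameter at most one -/

theorem continuous_logKernel_toENNReal :
    Continuous fun x : ℂ × ℂ => (logKernel x.1 x.2).toENNReal := by
  unfold logKernel
  exact ((ENNReal.continuous_log.comp continuous_edist).neg).ereal_toENNReal

theorem neg_logKernel_toENNReal_eq_zero {z w : ℂ} (h : dist z w ≤ 1) :
    (-logKernel z w).toENNReal = 0 := by
  rw [logKernel, neg_neg, EReal.toENNReal_eq_zero_iff, ENNReal.log_le_zero_iff, edist_dist]
  exact ENNReal.ofReal_le_one.2 h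

theorem logKernel_toENNReal_of_ne {z w : ℂ} (h : z ≠ w) :
    (logKernel z w).toENNReal = ENNReal.ofReal (-Real.log ‖z - w‖) := by
  rw [logKernel, edist_dist, ENNReal.log_ofReal_of_pos (dist_pos.2 h), dist_eq_norm,
    ← EReal.coe_neg, EReal.toENNReal_of_ne_top (EReal.coe_ne_top _), EReal.toReal_coe]

theorem logKernel_toENNReal_self (z : ℂ) : (logKernel z z).toENNReal = ⊤ := by
  simp [logKernel]

theorem logKernel_comm (z w : ℂ) : logKernel z w = logKernel w z := by
  rw [logKernel, logKernel, edist_comm]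

theorem logEnergy_eq_lintegral {E : Set ℂ} (hE : ∀ z ∈ E, ∀ w ∈ E, dist z w ≤ 1)
    {μ : Measure ℂ} (hμ : μ Eᶜ = 0) :
    logEnergy μ = ((∫⁻ z, ∫⁻ w, (logKernel z w).toENNReal ∂μ ∂μ : ENNReal) : EReal) := by
  have hae : ∀ᵐ z ∂μ, z ∈ E := by rwa [ae_iff]
  have h : (∫⁻ z, ∫⁻ w, (-logKernel z w).toENNReal ∂μ ∂μ : ENNReal) = 0 := by
    refine lintegral_eq_zero_of_ae_eq_zero ?_
    filter_upwards [hae] with z hz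
    refine lintegral_eq_zero_of_ae_eq_zero ?_
    filter_upwards [hae] with w hw
    exact neg_logKernel_toENNReal_eq_zero (hE z hz w hw)
  rw [logEnergy, h]
  simp

/-! ### Energy bounds from Vandermonde determinants -/

theorem ofReal_neg_log_prod_le_sum {ι : Type*} (s : Finset ι) (z w : ι → ℂ) {B : ℝ}
    (h : ∏ i ∈ s, ‖z i - w i‖ ≤ B) :
    ENNReal.ofReal (-Real.log B) ≤ ∑ i ∈ s, (logKernel (z i) (w i)).toENNReal := by
  by_cases hne : ∀ i ∈ s, z i ≠ w i
  · have hpos : ∀ i ∈ s, 0 < ‖z i - w i‖ := fun i hi => norm_pos_iff.2 (sub_ne_zero.2 (hne i hi))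
    rw [Finset.sum_congr rfl fun i hi => logKernel_toENNReal_of_ne (hne i hi)]
    have hsum : -Real.log B ≤ ∑ i ∈ s, -Real.log ‖z i - w i‖ := by
      rw [Finset.sum_neg_distrib, ← Real.log_prod fun i hi => (hpos i hi).ne']
      exact neg_le_neg (Real.log_le_log (Finset.prod_pos hpos) h)
    refine (ENNReal.ofReal_le_ofReal hsum).trans ?_
    exact Finset.le_sum_of_subadditive _ ENNReal.ofReal_zero.le
      (fun _ _ => ENNReal.ofReal_add_le) _ _
  -- Two coinciding points make the right side infinite, so the junk value `Real.log 0 = 0` never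
  -- enters.
  · push Not at hne
    obtain ⟨i, hi, hzw⟩ := hne
    have : (∑ i ∈ s, (logKernel (z i) (w i)).toENNReal) = ⊤ := by
      rw [ENNReal.sum_eq_top]
      exact ⟨i, hi, by rw [hzw, logKernel_toENNReal_self]⟩
    rw [this]
    exact le_top

theorem lintegral_pi_pair {N : ℕ} (μ : Measure ℂ) [IsProbabilityMeasure μ] {i j : Fin N}
    (hij : i ≠ j) {f : ℂ × ℂ → ENNReal} (hf : Measurable f) :
    ∫⁻ v, f (v i, v j) ∂(Measure.pi fun _ : Fin N => μ) = ∫⁻ z, ∫⁻ w, f (z, w) ∂μ ∂μ := by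
  have hind : ProbabilityTheory.IndepFun (fun v : Fin N → ℂ => v i) (fun v => v j)
      (Measure.pi fun _ : Fin N => μ) :=
    (ProbabilityTheory.iIndepFun_pi (μ := fun _ : Fin N => μ) (X := fun _ z => z)
      fun _ => aemeasurable_id).indepFun hij
  have hmap := (ProbabilityTheory.indepFun_iff_map_prod_eq_prod_map_map
    (measurable_pi_apply i).aemeasurable (measurable_pi_apply j).aemeasurable).1 hind
  have hev : ∀ i, (Measure.pi fun _ : Fin N => μ).map (fun v => v i) = μ := fun i =>
    (measurePreserving_eval (fun _ : Fin N => μ) i).map_eq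
  rw [hev, hev] at hmap
  rw [← lintegral_prod _ hf.aemeasurable, ← hmap, lintegral_map hf (by fun_prop)]

theorem sum_card_Ioi (N : ℕ) : (∑ i : Fin N, (Finset.Ioi i).card : ℕ) * 2 = N * (N - 1) := by
  have : (∑ i : Fin N, (Finset.Ioi i).card) = ∑ i ∈ Finset.range N, i := by
    simp only [Fin.card_Ioi]
    rw [Fin.sum_univ_eq_sum_range (fun i => N - 1 - i), Finset.sum_range_reflect (fun i => i)]
  rw [this, Finset.sum_range_id_mul_two]

theorem ofReal_neg_log_le_sum_vandermonde {N : ℕ} {v : Fin N → ℂ} {B : ℝ}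
    (h : ‖(Matrix.vandermonde v).det‖ ≤ B) :
    ENNReal.ofReal (-Real.log B) ≤
      ∑ i, ∑ j ∈ Finset.Ioi i, (logKernel (v j) (v i)).toENNReal := by
  rw [Matrix.det_vandermonde, norm_prod] at h
  simp only [norm_prod] at h
  rw [Finset.prod_sigma'] at h
  rw [Finset.sum_sigma']
  exact ofReal_neg_log_prod_le_sum _ (fun x : Σ _ : Fin N, Fin N => v x.2) (fun x => v x.1) h

theorem lintegral_pi_sum_logKernel (N : ℕ) (μ : Measure ℂ) [IsProbabilityMeasure μ] :
    ∫⁻ v, ∑ i, ∑ j ∈ Finset.Ioi i, (logKernel (v j) (v i)).toENNReal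
        ∂(Measure.pi fun _ : Fin N => μ) =
      ((∑ i : Fin N, (Finset.Ioi i).card : ℕ) : ENNReal) *
        ∫⁻ z, ∫⁻ w, (logKernel z w).toENNReal ∂μ ∂μ := by
  have hm := continuous_logKernel_toENNReal.measurable
  have hmi : ∀ i j : Fin N, Measurable fun v : Fin N → ℂ =>
      (logKernel (v j) (v i)).toENNReal := fun i j =>
    ((measurable_pi_apply j).edist (measurable_pi_apply i)).ennreal_log.neg.ereal_toENNReal
  generalize hI : ∫⁻ z, ∫⁻ w, (logKernel z w).toENNReal ∂μ ∂μ = I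
  have hpair : ∀ i j : Fin N, j ∈ Finset.Ioi i →
      ∫⁻ v, (logKernel (v j) (v i)).toENNReal ∂(Measure.pi fun _ : Fin N => μ) = I := by
    intro i j hj
    rw [← hI]
    exact lintegral_pi_pair (f := fun x => (logKernel x.1 x.2).toENNReal) μ
      (Finset.mem_Ioi.1 hj).ne' hm
  rw [lintegral_finsetSum _ fun i _ => Finset.measurable_fun_sum _ fun j _ => hmi i j,
    Nat.cast_sum, Finset.sum_mul]
  refine Finset.sum_congr rfl fun i _ => ?_
  rw [lintegral_finsetSum _ fun j _ => hmi i j, ← nsmul_eq_mul]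
  exact Finset.sum_eq_card_nsmul (hpair i)

theorem ae_pi_mem {E : Set ℂ} (N : ℕ) {μ : Measure ℂ} [IsProbabilityMeasure μ]
    (hμ : μ Eᶜ = 0) : ∀ᵐ v ∂(Measure.pi fun _ : Fin N => μ), ∀ i, v i ∈ E := by
  rw [ae_all_iff]
  intro i
  have h : ∀ᵐ z ∂μ, z ∈ E := by rwa [ae_iff]
  exact (measurePreserving_eval (fun _ : Fin N => μ) i).quasiMeasurePreserving.ae h

/-- Average the pointwise Vandermonde bound over `N` independent `μ`-random points: each pair
contributes one copy of the energy. -/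
theorem ofReal_neg_log_le_energy {E : Set ℂ} {N : ℕ} {B : ℝ}
    (h : ∀ v : Fin N → ℂ, (∀ i, v i ∈ E) → ‖(Matrix.vandermonde v).det‖ ≤ B)
    {μ : Measure ℂ} [IsProbabilityMeasure μ] (hμ : μ Eᶜ = 0) :
    ENNReal.ofReal (-Real.log B) ≤ ((∑ i : Fin N, (Finset.Ioi i).card : ℕ) : ENNReal) *
      ∫⁻ z, ∫⁻ w, (logKernel z w).toENNReal ∂μ ∂μ := by
  rw [← lintegral_pi_sum_logKernel]
  calc ENNReal.ofReal (-Real.log B)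
      = ∫⁻ _, ENNReal.ofReal (-Real.log B) ∂(Measure.pi fun _ : Fin N => μ) := by simp
    _ ≤ _ := lintegral_mono_ae ((ae_pi_mem N hμ).mono fun v hv =>
        ofReal_neg_log_le_sum_vandermonde (h v hv))

/-! ### Capacity and sup norms of monic polynomials -/

theorem norm_det_le_factorial_mul_prod {N : ℕ} (A : Matrix (Fin N) (Fin N) ℂ) (c : Fin N → ℝ)
    (h : ∀ i j, ‖A i j‖ ≤ c j) : ‖A.det‖ ≤ N.factorial * ∏ j, c j := by
  rw [Matrix.det_apply']
  refine (norm_sum_le _ _).trans ?_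
  have : ∀ σ ∈ (Finset.univ : Finset (Equiv.Perm (Fin N))),
      ‖((Equiv.Perm.sign σ : ℤ) : ℂ) * ∏ i, A (σ i) i‖ ≤ ∏ j, c j := by
    intro σ _
    rw [norm_mul, norm_prod]
    have hs : ‖((Equiv.Perm.sign σ : ℤ) : ℂ)‖ = 1 := by
      rcases Int.units_eq_one_or (Equiv.Perm.sign σ) with h | h <;> simp [h]
    rw [hs, one_mul]
    exact Finset.prod_le_prod (fun _ _ => norm_nonneg _) fun i _ => h _ _
  refine (Finset.sum_le_card_nsmul _ _ _ this).trans ?_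
  simp [Fintype.card_perm]

theorem prod_range_pow_div (ρ : ℝ) {n : ℕ} (hn : 0 < n) (m : ℕ) :
    ∏ i ∈ Finset.range (n * m), ρ ^ (i / n) = ρ ^ (n * (m * (m - 1) / 2)) := by
  induction m with
  | zero => simp
  | succ m ih =>
    rw [Nat.mul_succ, Finset.prod_range_add, ih]
    have : ∀ x ∈ Finset.range n, ρ ^ ((n * m + x) / n) = ρ ^ m := by
      intro x hx
      rw [Nat.mul_add_div hn, Nat.div_eq_of_lt (Finset.mem_range.1 hx), add_zero]
    rw [Finset.prod_congr rfl this, Finset.prod_const, Finset.card_range, ← pow_mul, ← pow_add]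
    congr 1
    rw [mul_comm m n, ← mul_add]
    congr 1
    rw [← Finset.sum_range_id, ← Finset.sum_range_id, Finset.sum_range_succ]

/-- The determinant is unchanged when monomials are replaced by the monic polynomials `p ^ (i / n) *
(X - a) ^ (i % n)` of degree `i`. On `E` the second factor has modulus at most 1. -/
theorem norm_det_vandermonde_le {E : Set ℂ} (hE : ∀ z ∈ E, ∀ w ∈ E, dist z w ≤ 1)
    {a : ℂ} (ha : a ∈ E) {p : ℂ[X]} (hp : p.Monic) {n : ℕ} (hnd : p.natDegree = n)
    (hn : 0 < n) {ρ : ℝ} (hρ : ∀ z ∈ E, ‖p.eval z‖ ≤ ρ) (m : ℕ) (v : Fin (n * m) → ℂ)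
    (hv : ∀ i, v i ∈ E) :
    ‖(Matrix.vandermonde v).det‖ ≤
      (n * m).factorial * ρ ^ (n * (m * (m - 1) / 2)) := by
  have hρ0 : 0 ≤ ρ := (norm_nonneg _).trans (hρ a ha)
  have hmon : ∀ i : ℕ, (p ^ (i / n) * (X - C a) ^ (i % n)).Monic := fun i =>
    (hp.pow _).mul ((monic_X_sub_C a).pow _)
  rw [Matrix.det_eval_matrixOfPolynomials_eq_det_vandermonde v
    (fun i => p ^ ((i : ℕ) / n) * (X - C a) ^ ((i : ℕ) % n))
    (fun i => by
      rw [(hp.pow _).natDegree_mul ((monic_X_sub_C a).pow _), hp.natDegree_pow,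
        (monic_X_sub_C a).natDegree_pow, natDegree_X_sub_C, mul_one, hnd]
      exact Nat.div_add_mod' _ _)
    (fun i => hmon i)]
  rw [← prod_range_pow_div ρ hn, ← Fin.prod_univ_eq_prod_range (fun i => ρ ^ (i / n))]
  refine norm_det_le_factorial_mul_prod _ _ fun i j => ?_
  rw [Matrix.of_apply, eval_mul, eval_pow, eval_pow, norm_mul, norm_pow, norm_pow]
  have h1 : ‖(X - C a).eval (v i)‖ ≤ 1 := by
    simpa [dist_eq_norm] using hE _ (hv i) a ha
  calc _ ≤ ρ ^ ((j : ℕ) / n) * 1 := by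
        gcongr
        · exact hρ _ (hv i)
        · exact pow_le_one₀ (norm_nonneg _) h1
    _ = _ := mul_one _

/-- Use `n * m` points, divide by `n * m ^ 2 / 2` and let `m → ∞`; the factorial only contributes
`O(log m / m)`. -/
theorem neg_log_le_natDegree_mul_energy {E : Set ℂ} (hE : ∀ z ∈ E, ∀ w ∈ E, dist z w ≤ 1)
    {a : ℂ} (ha : a ∈ E) {p : ℂ[X]} (hp : p.Monic) {n : ℕ} (hnd : p.natDegree = n)
    (hn : 0 < n) {ρ : ℝ} (hρ0 : 0 < ρ) (hρ : ∀ z ∈ E, ‖p.eval z‖ ≤ ρ)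
    {μ : Measure ℂ} [IsProbabilityMeasure μ] (hμ : μ Eᶜ = 0)
    (hI : ∫⁻ z, ∫⁻ w, (logKernel z w).toENNReal ∂μ ∂μ ≠ ⊤) :
    -Real.log ρ ≤ n * (∫⁻ z, ∫⁻ w, (logKernel z w).toENNReal ∂μ ∂μ).toReal := by
  have key : ∀ m : ℕ, ENNReal.ofReal
      (-Real.log ((n * m).factorial * ρ ^ (n * (m * (m - 1) / 2)))) ≤ _ := fun m =>
    ofReal_neg_log_le_energy (norm_det_vandermonde_le hE ha hp hnd hn hρ m) hμ
  generalize ∫⁻ z, ∫⁻ w, (logKernel z w).toENNReal ∂μ ∂μ = I at key hI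
  have hn' : (0 : ℝ) < n := by exact_mod_cast hn
  have hbound : ∀ m : ℕ, 0 < m →
      -2 * (Real.log n * (m : ℝ)⁻¹ + Real.log m / m) - (1 - (m : ℝ)⁻¹) * Real.log ρ ≤
        (n - (m : ℝ)⁻¹) * I.toReal := by
    intro m hm
    have hm' : (0 : ℝ) < m := by exact_mod_cast hm
    have h1 := key m
    rw [ENNReal.ofReal_le_iff_le_toReal (ENNReal.mul_ne_top (ENNReal.natCast_ne_top _) hI),
      ENNReal.toReal_mul, ENNReal.toReal_natCast,
      Real.log_mul (by positivity) (by positivity), Real.log_pow] at h1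
    have hcard : ((∑ i : Fin (n * m), (Finset.Ioi i).card : ℕ) : ℝ) * 2 =
        (n * m) * (n * m - 1) := by
      have := sum_card_Ioi (n * m)
      have h2 : 1 ≤ n * m := Nat.mul_pos hn hm
      rw [← Nat.cast_inj (R := ℝ)] at this
      push_cast [Nat.cast_sub h2] at this ⊢
      exact this
    have hdeg : ((n * (m * (m - 1) / 2) : ℕ) : ℝ) * 2 = n * (m * (m - 1)) := by
      have := Nat.div_mul_cancel (Nat.even_mul_pred_self m).two_dvd
      rw [← Nat.cast_inj (R := ℝ)] at this
      push_cast [Nat.cast_sub (show 1 ≤ m from hm)] at this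
      rw [Nat.cast_mul, mul_assoc, this]
    have hfac : Real.log ((n * m).factorial) ≤ n * m * (Real.log n + Real.log m) := by
      have : ((n * m).factorial : ℝ) ≤ (n * m : ℝ) ^ (n * m) := by
        exact_mod_cast Nat.factorial_le_pow (n * m)
      have := Real.log_le_log (by positivity) this
      rwa [Real.log_pow, Real.log_mul hn'.ne' hm'.ne', Nat.cast_mul] at this
    generalize ((∑ i : Fin (n * m), (Finset.Ioi i).card : ℕ) : ℝ) = c at h1 hcard
    generalize ((n * (m * (m - 1) / 2) : ℕ) : ℝ) = d at h1 hdeg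
    have hc : c = (n * m) * (n * m - 1) / 2 := by linarith
    have hd : d = n * (m * (m - 1)) / 2 := by linarith
    rw [hc, hd] at h1
    have h3 : (n * (m : ℝ) ^ 2) * (-2 * (Real.log n * (m : ℝ)⁻¹ + Real.log m / m)
        - (1 - (m : ℝ)⁻¹) * Real.log ρ) ≤
        (n * (m : ℝ) ^ 2) * ((n - (m : ℝ)⁻¹) * I.toReal) := by
      have e1 : (n * (m : ℝ) ^ 2) * (-2 * (Real.log n * (m : ℝ)⁻¹ + Real.log m / m)
          - (1 - (m : ℝ)⁻¹) * Real.log ρ) =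
          -2 * (n * m * (Real.log n + Real.log m)) - n * (m * (m - 1)) * Real.log ρ := by
        field_simp
      have e2 : (n * (m : ℝ) ^ 2) * ((n - (m : ℝ)⁻¹) * I.toReal) =
          (n * m) * (n * m - 1) * I.toReal := by
        field_simp
      rw [e1, e2]
      linarith
    exact le_of_mul_le_mul_left h3 (by positivity)
  have hinv : Filter.Tendsto (fun m : ℕ => (m : ℝ)⁻¹) Filter.atTop (𝓝 0) :=
    tendsto_inv_atTop_nhds_zero_nat
  have hlog : Filter.Tendsto (fun m : ℕ => Real.log m / m) Filter.atTop (𝓝 0) :=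
    (Real.isLittleO_log_id_atTop.tendsto_div_nhds_zero).comp tendsto_natCast_atTop_atTop
  have hl := ((((hinv.const_mul (Real.log n)).add hlog).const_mul (-2)).sub
    (((hinv.const_sub 1).mul_const (Real.log ρ))))
  have hr := (hinv.const_sub (n : ℝ)).mul_const I.toReal
  have := le_of_tendsto_of_tendsto hl hr
    (Filter.eventually_atTop.2 ⟨1, fun m hm => hbound m hm⟩)
  simpa using this

theorem logCapacity_le_of_le_robinConstant {E : Set ℂ} {c : ℝ}
    (h : ((-c : ℝ) : EReal) ≤ robinConstant E) : logCapacity E ≤ Real.exp c := by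
  have h1 : EReal.exp (-robinConstant E) ≤ EReal.exp c := by
    rw [EReal.exp_le_exp_iff, EReal.neg_le, ← EReal.coe_neg]
    exact h
  rw [EReal.exp_coe] at h1
  exact ENNReal.toReal_le_of_le_ofReal (Real.exp_pos _).le h1

theorem logCapacity_nonneg (E : Set ℂ) : 0 ≤ logCapacity E := ENNReal.toReal_nonneg

theorem logCapacity_pow_natDegree_le {E : Set ℂ} (hE : ∀ z ∈ E, ∀ w ∈ E, dist z w ≤ 1)
    (hne : E.Nonempty) {p : ℂ[X]} (hp : p.Monic) {ρ : ℝ} (hρ : ∀ z ∈ E, ‖p.eval z‖ ≤ ρ) :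
    logCapacity E ^ p.natDegree ≤ ρ := by
  obtain ⟨a, ha⟩ := hne
  rcases Nat.eq_zero_or_pos p.natDegree with hn | hn
  · have h1 := hρ a ha
    rw [hp.natDegree_eq_zero.1 hn, eval_one, norm_one] at h1
    simpa [hn] using h1
  -- The bound `ρ` may be zero; adding `ε` makes its logarithm meaningful.
  refine le_of_forall_pos_le_add fun ε hε => ?_
  have hpos : 0 < ρ + ε := add_pos_of_nonneg_of_pos ((norm_nonneg _).trans (hρ a ha)) hε
  have hn' : (0 : ℝ) < p.natDegree := by exact_mod_cast hn
  have hV : ((-(Real.log (ρ + ε) / p.natDegree) : ℝ) : EReal) ≤ robinConstant E := by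
    refine le_iInf fun μ => le_iInf fun _ => le_iInf fun hμ => ?_
    rw [logEnergy_eq_lintegral hE hμ]
    by_cases hI : ∫⁻ z, ∫⁻ w, (logKernel z w).toENNReal ∂μ ∂μ = ⊤
    · rw [hI, EReal.coe_ennreal_top]
      exact le_top
    · have := neg_log_le_natDegree_mul_energy hE ha hp rfl hn hpos
        (fun z hz => (hρ z hz).trans (by linarith)) hμ hI
      rw [← EReal.coe_ennreal_toReal hI, EReal.coe_le_coe_iff, ← neg_div,
        div_le_iff₀' hn']
      exact this
  calc logCapacity E ^ p.natDegree
      ≤ Real.exp (Real.log (ρ + ε) / p.natDegree) ^ p.natDegree :=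
        pow_le_pow_left₀ (logCapacity_nonneg E) (logCapacity_le_of_le_robinConstant hV) _
    _ = ρ + ε := by
        rw [← Real.exp_nat_mul, mul_div_cancel₀ _ hn'.ne', Real.exp_log hpos]

/-! ### Reflection of roots and the upper bound -/

/-- The point symmetric to `z` in the unit circle centred at `u`. -/
noncomputable def circleReflection (u z : ℂ) : ℂ := u + 1 / (starRingEnd ℂ) (z - u)

/-- With `s = z - u` and `t = w - u`, the difference of the squared sides is `(|s|² - 1)(1 - |t|²) ≥
0`. -/
theorem norm_sub_mul_norm_circleReflection_le {u z w : ℂ} (hz : 1 ≤ ‖z - u‖)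
    (hw : ‖w - u‖ ≤ 1) : ‖z - u‖ * ‖w - circleReflection u z‖ ≤ ‖w - z‖ := by
  have h0 : (starRingEnd ℂ) (z - u) ≠ 0 := by
    rw [Ne, map_eq_zero, ← norm_eq_zero]
    linarith
  rw [← RCLike.norm_conj (z - u), ← norm_mul]
  have e : (starRingEnd ℂ) (z - u) * (w - circleReflection u z) =
      (starRingEnd ℂ) (z - u) * (w - u) - 1 := by
    rw [circleReflection]
    field_simp
    ring
  rw [e, show w - z = (w - u) - (z - u) by ring]
  generalize z - u = s at *
  generalize w - u = t at *
  have hs : 1 ≤ Complex.normSq s := by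
    rw [Complex.normSq_eq_norm_sq]
    exact one_le_pow₀ hz
  have ht : Complex.normSq t ≤ 1 := by
    rw [Complex.normSq_eq_norm_sq]
    exact pow_le_one₀ (norm_nonneg _) hw
  refine le_of_sq_le_sq ?_ (norm_nonneg _)
  rw [Complex.sq_norm, Complex.sq_norm]
  have := mul_nonneg (sub_nonneg.2 hs) (sub_nonneg.2 ht)
  simp only [Complex.normSq_apply, Complex.sub_re, Complex.sub_im, Complex.mul_re,
    Complex.mul_im, Complex.conj_re, Complex.conj_im, Complex.one_re, Complex.one_im] at *
  linarith

/-- The points of the closed disc with centre `u` and radius `1` are left alone, the others are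
reflected in the unit circle centred at `u`. -/
noncomputable def foldIntoDisc (u z : ℂ) : ℂ := if 1 ≤ ‖z - u‖ then circleReflection u z else z

theorem max_mul_norm_sub_foldIntoDisc_le {u z w : ℂ} (hw : ‖w - u‖ ≤ 1) :
    max 1 ‖z - u‖ * ‖w - foldIntoDisc u z‖ ≤ ‖w - z‖ := by
  unfold foldIntoDisc
  split_ifs with h
  · rw [max_eq_right h]
    exact norm_sub_mul_norm_circleReflection_le h hw
  · rw [max_eq_left (le_of_not_ge h), one_mul]

theorem norm_eval_eq_prod_roots {p : ℂ[X]} (hp : p.Monic) (w : ℂ) :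
    ‖p.eval w‖ = (p.roots.map fun z => ‖w - z‖).prod := by
  have h := (IsAlgClosed.splits p).eval_eq_prod_roots_of_monic hp w
  rw [h]
  exact (map_multiset_prod (normHom : ℂ →*₀ ℝ) _).trans (by rw [Multiset.map_map]; rfl)

/-- The roots of the cofactor only contribute factors at least 1. -/
theorem norm_eval_factor_le {p q : ℂ[X]} (hp : p.Monic) (hq : q.Monic) (hqp : q ∣ p) (u : ℂ) :
    ‖q.eval u‖ ≤ (p.roots.map fun z => max 1 ‖z - u‖).prod := by
  obtain ⟨r, rfl⟩ := hqp
  rw [roots_mul hp.ne_zero, Multiset.map_add, Multiset.prod_add, norm_eval_eq_prod_roots hq]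
  have h1 : (q.roots.map fun z => ‖u - z‖).prod ≤
      (q.roots.map fun z => max 1 ‖z - u‖).prod :=
    Multiset.prod_map_le_prod_map₀ _ _ (fun _ _ => norm_nonneg _)
      fun z _ => by rw [norm_sub_rev]; exact le_max_right _ _
  have h2 : 1 ≤ (r.roots.map fun z => max 1 ‖z - u‖).prod :=
    Multiset.one_le_prod_map fun _ _ => le_max_left _ _
  exact h1.trans (le_mul_of_one_le_right
    ((Multiset.prod_map_nonneg fun _ _ => norm_nonneg _).trans h1) h2)

theorem norm_eval_factor_mul_logCapacity_pow_le {E : Set ℂ}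
    (hE : ∀ z ∈ E, ∀ w ∈ E, dist z w ≤ 1) {p q : ℂ[X]} (hp : p.Monic) (hq : q.Monic)
    (hqp : q ∣ p) {u : ℂ} (hu : u ∈ E) {ρ : ℝ} (hρ : ∀ z ∈ E, ‖p.eval z‖ ≤ ρ) :
    ‖q.eval u‖ * logCapacity E ^ p.natDegree ≤ ρ := by
  set P : ℝ := (p.roots.map fun z => max 1 ‖z - u‖).prod with hP
  have hP0 : 0 < P := zero_lt_one.trans_le (Multiset.one_le_prod_map fun _ _ => le_max_left _ _)
  set s : ℂ[X] := ((p.roots.map (foldIntoDisc u)).map fun z => X - C z).prod with hs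
  have hsm : s.Monic := monic_multiset_prod_of_monic _ _ fun z _ => monic_X_sub_C z
  have hsd : s.natDegree = p.natDegree := by
    rw [hs, natDegree_multiset_prod_X_sub_C_eq_card, Multiset.card_map,
      (IsAlgClosed.splits p).natDegree_eq_card_roots]
  have hsw : ∀ w ∈ E, ‖s.eval w‖ ≤ ρ / P := by
    intro w hw
    rw [le_div_iff₀' hP0]
    refine le_trans ?_ (hρ w hw)
    rw [norm_eval_eq_prod_roots hsm, norm_eval_eq_prod_roots hp, hs,
      roots_multiset_prod_X_sub_C, Multiset.map_map, hP, ← Multiset.prod_map_mul]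
    refine Multiset.prod_map_le_prod_map₀ _ _ 
      (fun z _ => mul_nonneg (zero_le_one.trans (le_max_left _ _)) (norm_nonneg _)) fun z _ => ?_
    exact max_mul_norm_sub_foldIntoDisc_le (by simpa [dist_eq_norm] using hE w hw u hu)
  have h := logCapacity_pow_natDegree_le hE ⟨u, hu⟩ hsm hsw
  rw [hsd, le_div_iff₀' hP0] at h
  exact (mul_le_mul_of_nonneg_right (norm_eval_factor_le hp hq hqp u)
    (pow_nonneg (logCapacity_nonneg E) _)).trans h

/-! ### Greedy sequences and limits of empirical measures -/

/-- The sequence whose `n`-th term is chosen by `g` as a function of the preceding terms. -/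
def historySeq {α : Type*} (g : ∀ n, (Fin n → α) → α) : ℕ → α
  | n => g n fun j => historySeq g j
termination_by n => n
decreasing_by exact j.2

theorem exists_seq_forall_history {α : Type*} (P : ∀ n, (Fin n → α) → α → Prop)
    (h : ∀ n f, ∃ a, P n f a) : ∃ z : ℕ → α, ∀ n, P n (fun j => z j) (z n) := by
  choose g hg using h
  refine ⟨historySeq g, fun n => ?_⟩
  have e : historySeq g n = g n fun j => historySeq g j := by rw [historySeq]
  rw [e]
  exact hg _ _

section Empirical

variable {X : Type*} [MeasurableSpace X]

/-- The uniform probability measure on the first `N + 1` terms of a sequence. -/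
noncomputable def empiricalMeasure (z : ℕ → X) (N : ℕ) : ProbabilityMeasure X :=
  ⟨((N + 1 : ℕ) : ENNReal)⁻¹ • ∑ i ∈ Finset.range (N + 1), Measure.dirac (z i), ⟨by
    simp only [Measure.smul_apply, Measure.coe_finsetSum, Finset.sum_apply, measure_univ,
      Finset.sum_const, Finset.card_range, smul_eq_mul, nsmul_eq_mul, mul_one]
    exact ENNReal.inv_mul_cancel (by simp) (ENNReal.natCast_ne_top _)⟩⟩

theorem lintegral_empiricalMeasure (z : ℕ → X) (N : ℕ) {f : X → ENNReal} (hf : Measurable f) :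
    ∫⁻ x, f x ∂(empiricalMeasure z N : Measure X) =
      ((N + 1 : ℕ) : ENNReal)⁻¹ * ∑ i ∈ Finset.range (N + 1), f (z i) := by
  rw [empiricalMeasure, ProbabilityMeasure.coe_mk, lintegral_smul_measure,
    lintegral_finsetSum_measure, smul_eq_mul]
  simp only [lintegral_dirac' _ hf]

theorem lintegral_empiricalMeasure_prod (z : ℕ → X) (N : ℕ) {f : X × X → ENNReal}
    (hf : Measurable f) :
    ∫⁻ x, f x ∂((empiricalMeasure z N).prod (empiricalMeasure z N) : Measure (X × X)) =
      ((N + 1 : ℕ) : ENNReal)⁻¹ * (((N + 1 : ℕ) : ENNReal)⁻¹ *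
        ∑ i ∈ Finset.range (N + 1), ∑ j ∈ Finset.range (N + 1), f (z i, z j)) := by
  rw [ProbabilityMeasure.toMeasure_prod, lintegral_prod _ hf.aemeasurable,
    lintegral_empiricalMeasure z N hf.lintegral_prod_right']
  congr 1
  rw [Finset.mul_sum]
  exact Finset.sum_congr rfl fun i _ =>
    lintegral_empiricalMeasure z N (hf.comp measurable_prodMk_left)

omit [MeasurableSpace X] in
theorem sum_range_sum_range_le {K : X × X → ENNReal} (hK : ∀ x y, K (x, y) = K (y, x))
    {z : ℕ → X} {c M : ENNReal} (hM : ∀ x, K x ≤ M)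
    (h : ∀ i, ∑ j ∈ Finset.range i, K (z i, z j) ≤ i * c) (N : ℕ) :
    ∑ i ∈ Finset.range N, ∑ j ∈ Finset.range N, K (z i, z j) ≤ N * M + N * (N * c) := by
  induction N with
  | zero => simp
  | succ N ih =>
    rw [Finset.sum_range_succ]
    simp only [Finset.sum_range_succ, Finset.sum_add_distrib]
    have h1 : ∑ i ∈ Finset.range N, K (z i, z N) ≤ N * c := by
      simpa only [hK _ (z N)] using h N
    calc _ ≤ (N * M + N * (N * c)) + N * c + (N * c + M) :=
          add_le_add (add_le_add ih h1) (add_le_add (h N) (hM _))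
      -- The spare `c` completes `N² + 2N` to `(N + 1)²`.
      _ ≤ (N * M + N * (N * c)) + N * c + (N * c + M) + c := le_self_add
      _ = _ := by push_cast; ring

end Empirical

/-- Weak convergence needs bounded integrands, and `K` may be infinite on the diagonal. Truncated at
`M`, the diagonal adds at most `M / (N + 1)` to the empirical energy, which vanishes in the limit;
monotone convergence in `M` then recovers `K`. -/
theorem exists_probabilityMeasure_energy_le {X : Type*} [MeasurableSpace X] [MetricSpace X]
    [CompactSpace X] [BorelSpace X] {K : X × X → ENNReal} (hKc : Continuous K)
    (hK : ∀ x y, K (x, y) = K (y, x)) {z : ℕ → X} {c : ENNReal}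
    (h : ∀ i, ∑ j ∈ Finset.range i, K (z i, z j) ≤ i * c) :
    ∃ μ : ProbabilityMeasure X, ∫⁻ x, ∫⁻ y, K (x, y) ∂(μ : Measure X) ∂(μ : Measure X) ≤ c := by
  obtain ⟨μ, -, hμ⟩ := (isCompact_univ (X := ProbabilityMeasure X)).ultrafilter_le_nhds
    ((Filter.hyperfilter ℕ).map (empiricalMeasure z)) (by simp)
  have hμ' : Filter.Tendsto (empiricalMeasure z) (Filter.hyperfilter ℕ : Filter ℕ) (𝓝 μ) := hμ
  have hprod : Filter.Tendsto (fun N => (empiricalMeasure z N).prod (empiricalMeasure z N))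
      (Filter.hyperfilter ℕ : Filter ℕ) (𝓝 (μ.prod μ)) :=
    (ProbabilityMeasure.continuous_prod.tendsto (μ, μ)).comp (hμ'.prodMk_nhds hμ')
  refine ⟨μ, ?_⟩
  have htrunc : ∀ M : ℕ, ∫⁻ x, min (K x) M ∂(μ.prod μ : Measure (X × X)) ≤ c := by
    intro M
    have hcont : Continuous fun x => min (K x) (M : ENNReal) := hKc.min continuous_const
    have hfin : ∀ x, min (K x) (M : ENNReal) ≠ ⊤ := fun x =>
      ne_top_of_le_ne_top (ENNReal.natCast_ne_top M) (min_le_right _ _)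
    let f : C(X × X, NNReal) := ⟨fun x => (min (K x) (M : ENNReal)).toNNReal,
      ENNReal.continuousOn_toNNReal.comp_continuous hcont hfin⟩
    have hf : ∀ x, (f x : ENNReal) = min (K x) M := fun x => ENNReal.coe_toNNReal (hfin x)
    have hlim := ((ProbabilityMeasure.continuous_lintegral_continuousMap f).tendsto
      (μ.prod μ)).comp hprod
    simp only [Function.comp_def, hf] at hlim
    have hb : ∀ N, ∫⁻ x, min (K x) M
        ∂((empiricalMeasure z N).prod (empiricalMeasure z N) : Measure (X × X)) ≤
          M * ((N + 1 : ℕ) : ENNReal)⁻¹ + c := by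
      intro N
      rw [lintegral_empiricalMeasure_prod z N hcont.measurable]
      have hs := sum_range_sum_range_le (K := fun x => min (K x) M) (z := z) (c := c)
        (fun x y => by rw [hK]) (fun x => min_le_right _ _)
        (fun i => (Finset.sum_le_sum fun j _ => min_le_left _ _).trans (h i)) (N + 1)
      have hn : ((N + 1 : ℕ) : ENNReal)⁻¹ * ((N + 1 : ℕ) : ENNReal) = 1 :=
        ENNReal.inv_mul_cancel (by simp) (ENNReal.natCast_ne_top _)
      generalize ((N + 1 : ℕ) : ENNReal) = n at *
      calc _ ≤ n⁻¹ * (n⁻¹ * (n * M + n * (n * c))) := by gcongr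
        _ = (n⁻¹ * n) * M * n⁻¹ + (n⁻¹ * n) * (n⁻¹ * n) * c := by ring
        _ = _ := by rw [hn]; ring
    have hz : Filter.Tendsto (fun N : ℕ => M * ((N + 1 : ℕ) : ENNReal)⁻¹ + c)
        Filter.atTop (𝓝 (M * 0 + c)) :=
      (ENNReal.Tendsto.const_mul ((Filter.tendsto_add_atTop_iff_nat 1).2
        ENNReal.tendsto_inv_nat_nhds_zero) (Or.inr (ENNReal.natCast_ne_top M))).add
        tendsto_const_nhds
    rw [mul_zero, zero_add] at hz
    exact le_of_tendsto_of_tendsto' hlim (hz.mono_left Nat.hyperfilter_le_atTop) hb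
  have hsup : ∀ x, K x = ⨆ M : ℕ, min (K x) (M : ENNReal) := fun x => by
    rw [← inf_iSup_eq, ENNReal.iSup_natCast, inf_top_eq]
  rw [← lintegral_prod (μ := (μ : Measure X)) (ν := (μ : Measure X)) K
    hKc.measurable.aemeasurable, ← ProbabilityMeasure.toMeasure_prod,
    lintegral_congr hsup, lintegral_iSup (fun M => (hKc.min continuous_const).measurable)
      fun a b hab x => min_le_min_left _ (by exact_mod_cast hab)]
  exact iSup_le htrunc

/-! ### Leja points and the lower bound -/

theorem exists_leja_sequence {E : Set ℂ} (hE : IsCompact E) (hne : E.Nonempty) {C : ℝ}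
    (hC : C ∈ factorConstants E) :
    ∃ z : ℕ → E, ∀ n, 1 ≤ C ^ n * ∏ j ∈ Finset.range n, ‖(z n : ℂ) - z j‖ := by
  obtain ⟨z, hz⟩ := exists_seq_forall_history
    (P := fun n (f : Fin n → E) (a : E) => 1 ≤ C ^ n * ∏ j, ‖(a : ℂ) - f j‖) (by
      intro n f
      set p : ℂ[X] := ∏ j, (X - Polynomial.C (f j : ℂ)) with hp
      have hpm : p.Monic := monic_prod_of_monic _ _ fun j _ => monic_X_sub_C _
      have hpd : p.natDegree = n := by
        rw [hp, natDegree_prod_of_monic _ _ fun j _ => monic_X_sub_C _]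
        simp
      have hev : ∀ w, ‖p.eval w‖ = ∏ j, ‖w - f j‖ := fun w => by
        rw [hp, eval_prod, norm_prod]
        simp
      -- The next point maximises on `E` the modulus of the polynomial vanishing at the previous
      -- ones.
      have h := hC p 1 hpm monic_one (one_dvd _)
      obtain ⟨w, hw, hmax⟩ := hE.exists_isMaxOn hne
        (p.continuous.norm.continuousOn (s := E))
      have : Nonempty E := hne.to_subtype
      have hsup : polySupNorm E p = ‖p.eval w‖ :=
        le_antisymm (ciSup_le fun x => hmax x.2)
          (le_ciSup (f := fun x : E => ‖p.eval (x : ℂ)‖)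
            ⟨_, Set.forall_mem_range.2 fun x => hmax x.2⟩ ⟨w, hw⟩)
      have hone : polySupNorm E 1 = 1 := by simp [polySupNorm]
      rw [hone, hpd, hsup, hev] at h
      exact ⟨⟨w, hw⟩, h⟩)
  refine ⟨z, fun n => ?_⟩
  rw [← Fin.prod_univ_eq_prod_range (fun j => ‖(z n : ℂ) - z j‖)]
  exact hz n

theorem one_le_of_mem_factorConstants {E : Set ℂ} (hE : IsCompact E) (hne : E.Nonempty)
    (hd : ∀ z ∈ E, ∀ w ∈ E, dist z w ≤ 1) {C : ℝ} (hC : C ∈ factorConstants E) : 1 ≤ C := by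
  -- Two points suffice: `1 ≤ C * |z 1 - z 0|` with a distance at most 1.
  obtain ⟨z, hz⟩ := exists_leja_sequence hE hne hC
  have h := hz 1
  rw [pow_one, Finset.prod_range_one, ← dist_eq_norm] at h
  have hle := hd _ (z 1).2 _ (z 0).2
  have h0 : 0 < C := by
    by_contra! hneg
    linarith [mul_nonpos_of_nonpos_of_nonneg hneg (dist_nonneg (x := (z 1 : ℂ)) (y := z 0))]
  linarith [mul_le_of_le_one_right h0.le hle]

theorem robinConstant_le_log {E : Set ℂ} (hE : IsCompact E) (hne : E.Nonempty)
    (hd : ∀ z ∈ E, ∀ w ∈ E, dist z w ≤ 1) {C : ℝ} (hC : C ∈ factorConstants E) :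
    robinConstant E ≤ (Real.log C : EReal) := by
  have hC1 := one_le_of_mem_factorConstants hE hne hd hC
  have hC0 : 0 < C := zero_lt_one.trans_le hC1
  obtain ⟨z, hz⟩ := exists_leja_sequence hE hne hC
  have hpos : ∀ n, 0 < ∏ j ∈ Finset.range n, ‖(z n : ℂ) - z j‖ := fun n =>
    pos_of_mul_pos_right (zero_lt_one.trans_le (hz n)) (pow_nonneg hC0.le n)
  have hsum : ∀ i, ∑ j ∈ Finset.range i, (logKernel (z i) (z j)).toENNReal ≤
      i * ENNReal.ofReal (Real.log C) := by
    intro i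
    have hne' : ∀ j ∈ Finset.range i, (0 : ℝ) < ‖(z i : ℂ) - z j‖ := fun j hj =>
      (norm_nonneg _).lt_of_ne' (Finset.prod_ne_zero_iff.1 (hpos i).ne' j hj)
    rw [Finset.sum_congr rfl fun j hj =>
        logKernel_toENNReal_of_ne (sub_ne_zero.1 (norm_pos_iff.1 (hne' j hj))),
      ← ENNReal.ofReal_sum_of_nonneg fun j _ => ?_, Finset.sum_neg_distrib,
      ← Real.log_prod fun j hj => (hne' j hj).ne', ← ENNReal.ofReal_natCast,
      ← ENNReal.ofReal_mul (Nat.cast_nonneg _)]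
    · refine ENNReal.ofReal_le_ofReal ?_
      have := Real.log_nonneg (hz i)
      rw [Real.log_mul (pow_pos hC0 _).ne' (hpos i).ne', Real.log_pow] at this
      linarith
    -- Here `diam E ≤ 1` prevents `ENNReal.ofReal` from truncating any term of the sum.
    · rw [neg_nonneg]
      refine Real.log_nonpos (norm_nonneg _) ?_
      rw [← dist_eq_norm]
      exact hd _ (z i).2 _ (z j).2
  have : CompactSpace E := isCompact_iff_compactSpace.1 hE
  obtain ⟨μ, hμ⟩ := exists_probabilityMeasure_energy_le
    (K := fun x : E × E => (logKernel x.1 x.2).toENNReal)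
    (continuous_logKernel_toENNReal.comp (by fun_prop :
      Continuous fun x : E × E => ((x.1 : ℂ), (x.2 : ℂ))))
    (fun x y => by simp only [logKernel_comm]) hsum
  have hm : Measurable fun x : ℂ × ℂ => (logKernel x.1 x.2).toENNReal :=
    continuous_logKernel_toENNReal.measurable
  set ν : Measure ℂ := (μ : Measure E).map Subtype.val with hν
  have hνp : IsProbabilityMeasure ν :=
    Measure.isProbabilityMeasure_map measurable_subtype_coe.aemeasurable
  have hνE : ν Eᶜ = 0 := by
    rw [hν, Measure.map_apply measurable_subtype_coe hE.measurableSet.compl]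
    simp
  have hνI : ∫⁻ z, ∫⁻ w, (logKernel z w).toENNReal ∂ν ∂ν ≤ ENNReal.ofReal (Real.log C) := by
    rw [hν, lintegral_map (Measurable.lintegral_prod_right' hm) measurable_subtype_coe]
    refine le_of_eq_of_le (lintegral_congr fun x => ?_) hμ
    exact lintegral_map (hm.comp measurable_prodMk_left) measurable_subtype_coe
  refine (iInf_le_of_le ν (iInf_le_of_le hνp (iInf_le _ hνE))).trans ?_
  rw [logEnergy_eq_lintegral hd hνE]
  refine (EReal.coe_ennreal_le_coe_ennreal_iff.2 hνI).trans ?_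
  rw [EReal.coe_ennreal_ofReal, max_eq_left (Real.log_nonneg hC1)]

theorem nonempty_of_logCapacity_pos {E : Set ℂ} (hcap : 0 < logCapacity E) : E.Nonempty := by
  by_contra h
  rw [Set.not_nonempty_iff_eq_empty] at h
  have hV : robinConstant E = ⊤ := by
    refine iInf_eq_top.2 fun μ => iInf_eq_top.2 fun hμ => iInf_eq_top.2 fun h0 => ?_
    rw [h, Set.compl_empty, measure_univ] at h0
    exact absurd h0 one_ne_zero
  rw [logCapacity, hV] at hcap
  simp at hcap

theorem one_div_le_logCapacity {E : Set ℂ} (hcap : 0 < logCapacity E) {C : ℝ} (hC : 0 < C)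
    (h : robinConstant E ≤ (Real.log C : EReal)) : 1 / C ≤ logCapacity E := by
  have h1 : EReal.exp ((-Real.log C : ℝ) : EReal) ≤ EReal.exp (-robinConstant E) := by
    rw [EReal.exp_le_exp_iff, EReal.coe_neg, EReal.neg_le_neg_iff]
    exact h
  rw [EReal.exp_coe, Real.exp_neg, Real.exp_log hC] at h1
  rw [one_div]
  -- An infinite exponential would have `toReal` equal to 0, contrary to positive capacity.
  refine (ENNReal.ofReal_le_iff_le_toReal fun htop => ?_).1 h1
  rw [logCapacity, htop] at hcap
  simp at hcap

theorem mainTheorem6 (E : Set ℂ) (hE : IsCompact E) (hcap : 0 < logCapacity E)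
    (hdiam : Metric.diam E ≤ 1) :
    IsLeast (factorConstants E) (1 / logCapacity E) := by
  have hne := nonempty_of_logCapacity_pos hcap
  have hd : ∀ z ∈ E, ∀ w ∈ E, dist z w ≤ 1 := fun z hz w hw =>
    (Metric.dist_le_diam_of_mem hE.isBounded hz hw).trans hdiam
  have : Nonempty E := hne.to_subtype
  refine ⟨fun p q hp hq hqp => ciSup_le fun u => ?_, fun C hC => ?_⟩
  · have hρ : ∀ z ∈ E, ‖p.eval z‖ ≤ polySupNorm E p := by
      intro z hz
      obtain ⟨B, hB⟩ := hE.exists_bound_of_continuousOn (p.continuous.continuousOn (s := E))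
      exact le_ciSup (f := fun x : E => ‖p.eval (x : ℂ)‖)
        ⟨B, Set.forall_mem_range.2 fun x => hB x x.2⟩ ⟨z, hz⟩
    have h := norm_eval_factor_mul_logCapacity_pow_le hd hp hq hqp u.2 hρ
    rw [one_div, inv_pow, ← div_eq_inv_mul]
    exact (le_div_iff₀ (pow_pos hcap _)).2 h
  · have hC0 := zero_lt_one.trans_le (one_le_of_mem_factorConstants hE hne hd hC)
    exact (one_div_le hC0 hcap).1
      (one_div_le_logCapacity hcap hC0 (robinConstant_le_log hE hne hd hC))
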